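/- Let $F$ be a field of characteristic $0$, let $L$ be an $F$-vector space of countably infinite dimension, and let $E$ be the Grassmann (exterior) algebra of $L$. For nonzero integers $m<n$ and a decomposition $L=L_m\oplus L_n$ with both summands infinite-dimensional, choose a basis $e_1,e_2,\dots$ of $L$ contained in $L_m\cup L_n$, put $\|e_k\|=m$ if $e_k\in L_m$ and $\|e_k\|=n$ if $e_k\in L_n$. Let $E_{(m,n)}^{(\infty,\infty)}$ denote $E$ with the $\mathbb{Z}$-grading whose component of degree $r$ is spanned by the basis monomials $e_{i_1}\cdots e_{i_k}$ ($i_1<\dots<i_k$, $k\ge 0$) with $\|e_{i_1}\|+\dots+\|e_{i_k}\|=r$. Let $F\langle X\mid\mathbb{Z}\rangle$ be the free unital associative algebra on countably infinitely many variables of each degree $i\in\mathbb{Z}$. For a $\mathbb{Z}$-graded algebra $A$, let $T_{\mathbb{Z}}(A)$ be the ideal of graded polynomial identities of $A$, i.e. of all $f\in F\langle X\mid\mathbb{Z}\rangle$ that vanish whenever each variable of degree $i$ is replaced by an element of $A_i$. Two $\mathbb{Z}$-graded algebras $A,B$ are PI-equivalent if $T_{\mathbb{Z}}(A)=T_{\mathbb{Z}}(B)$.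 A $T_{\mathbb{Z}}$-ideal is a two-sided ideal of $F\langle X\mid\mathbb{Z}\rangle$ invariant under all graded endomorphisms; $A$ generates the variety defined by a set $S$ of polynomials if $T_{\mathbb{Z}}(A)$ is the $T_{\mathbb{Z}}$-ideal generated by $S$. Write $\alpha(x)$ for the degree of a variable $x$, and $[a,b]=ab-ba$, $[a,b,c]=[[a,b],c]$. Let $\mathfrak{V}_1$ be the variety defined by the polynomials $[x_1,x_2,x_3]$ for variables of all degrees, and $\mathfrak{V}_2$ the variety defined by the polynomials $[x_1,x_2]$ with $\alpha(x_1)$ or $\alpha(x_2)$ even and $x_1x_2+x_2x_1$ with $\alpha(x_1)$ and $\alpha(x_2)$ both odd. **Theorem.** Let $m<0<n$ be integers with $\gcd(m,n)=1$. Then every homogeneous component of $E_{(m,n)}^{(\infty,\infty)}$ is nonzero, and: 1. if $mn$ is odd, then $E_{(m,n)}^{(\infty,\infty)}$ is PI-equivalent to $E_{(-1,1)}^{(\infty,\infty)}$ and generates $\mathfrak{V}_2$; 2. if $mn$ is even, then $E_{(m,n)}^{(\infty,\infty)}$ is PI-equivalent to $E_{(-1,2)}^{(\infty,\infty)}$ and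 generates $\mathfrak{V}_1$. Moreover, $E_{(-1,1)}^{(\infty,\infty)}$ and $E_{(-1,2)}^{(\infty,\infty)}$ are not PI-equivalent, so exactly one of the two alternatives holds. All of this holds for every choice of the decompositions and adapted bases of $L$ used to define the three graded algebras. -/

import Mathlib

open Module

namespace GradedGrassmann

noncomputable section

/-! ### Free `ℤ`-graded algebra, graded identities, `T`-ideals, PI-equivalence -/

section Identities

/-- The free unital associative algebra `F⟨X | ℤ⟩`. The variable of index `(i, k)` is the `k`-th
variable of degree `i`. -/
abbrev FreeGr (F : Type*) [Field F] : Type _ := FreeAlgebra F (ℤ × ℕ)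

/-- The `k`-th variable of degree `i`. -/
abbrev x (F : Type*) [Field F] (i : ℤ) (k : ℕ) : FreeGr F := FreeAlgebra.ι F (i, k)

/-- The homogeneous component of degree `i` of the free algebra: the span of the (noncommutative)
monomials whose variables have degrees with sum `i`. -/
def freeComponent (F : Type*) [Field F] (i : ℤ) : Submodule F (FreeGr F) :=
  Submodule.span F
    {f | ∃ l : List (ℤ × ℕ), (l.map Prod.fst).sum = i ∧ f = (l.map (FreeAlgebra.ι F)).prod}

variable {F : Type*} [Field F] {A B : Type*} [Ring A] [Algebra F A] [Ring B] [Algebra F B]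

/-- The ideal `T_ℤ(A)` of the `ℤ`-graded polynomial identities of a `ℤ`-graded algebra: the
polynomials which vanish under every substitution of each variable of degree `i` by an element of
the homogeneous component of degree `i`. -/
def gradedIdentities (𝒜 : ℤ → Submodule F A) [GradedAlgebra 𝒜] : TwoSidedIdeal (FreeGr F) :=
  TwoSidedIdeal.mk'
    {f | ∀ a : ℤ × ℕ → A, (∀ p, a p ∈ 𝒜 p.1) → FreeAlgebra.lift F a f = 0}
    (fun a _ => map_zero _)
    (fun hf hg a ha => by rw [map_add, hf a ha, hg a ha, add_zero])
    (fun hf a ha => by rw [map_neg, hf a ha, neg_zero])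
    (fun hg a ha => by rw [map_mul, hg a ha, mul_zero])
    (fun hf a ha => by rw [map_mul, hf a ha, zero_mul])

theorem mem_gradedIdentities (𝒜 : ℤ → Submodule F A) [GradedAlgebra 𝒜] (f : FreeGr F) :
    f ∈ gradedIdentities 𝒜 ↔
      ∀ a : ℤ × ℕ → A, (∀ p, a p ∈ 𝒜 p.1) → FreeAlgebra.lift F a f = 0 := by
  unfold gradedIdentities
  rw [TwoSidedIdeal.mem_mk']
  rfl

/-- Two `ℤ`-graded algebras are PI-equivalent if they satisfy the same graded identities. -/
def PIEquiv (𝒜 : ℤ → Submodule F A) [GradedAlgebra 𝒜]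
    (ℬ : ℤ → Submodule F B) [GradedAlgebra ℬ] : Prop :=
  gradedIdentities 𝒜 = gradedIdentities ℬ

/-- A `T_ℤ`-ideal: a two-sided ideal which is invariant under all graded endomorphisms. -/
def IsTIdeal (I : TwoSidedIdeal (FreeGr F)) : Prop :=
  ∀ φ : FreeGr F →ₐ[F] FreeGr F,
    (∀ i, ∀ f ∈ freeComponent F i, φ f ∈ freeComponent F i) → ∀ f ∈ I, φ f ∈ I

/-- The `T_ℤ`-ideal generated by a set of polynomials. -/
def tIdealSpan (S : Set (FreeGr F)) : TwoSidedIdeal (FreeGr F) :=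
  sInf {I | IsTIdeal I ∧ ∀ f ∈ S, f ∈ I}

/-- A graded algebra generates the variety of graded algebras defined by the identities in `S` if
its ideal of graded identities is the `T_ℤ`-ideal of that variety, the one generated by `S`. -/
def GeneratesVariety (𝒜 : ℤ → Submodule F A) [GradedAlgebra 𝒜] (S : Set (FreeGr F)) : Prop :=
  gradedIdentities 𝒜 = tIdealSpan S

variable (F)

/-- The identities defining the variety `𝔙₁`: the triple commutators
`[x₁, x₂, x₃] = [[x₁, x₂], x₃]` of variables of arbitrary degrees. -/
def definingV1 : Set (FreeGr F) :=
  {f | ∃ (i j l : ℤ) (p q r : ℕ), f = ⁅⁅x F i p, x F j q⁆, x F l r⁆}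

/-- The identities defining the variety `𝔙₂`: `[x₁, x₂]` if one of the degrees is even, and
`x₁ x₂ + x₂ x₁` if both degrees are odd. -/
def definingV2 : Set (FreeGr F) :=
  {f | ∃ (i j : ℤ) (p q : ℕ), (Even i ∨ Even j) ∧ f = ⁅x F i p, x F j q⁆} ∪
  {f | ∃ (i j : ℤ) (p q : ℕ), (Odd i ∧ Odd j) ∧ f = x F i p * x F j q + x F j q * x F i p}

end Identities

/-! ### The `2`-induced gradings of the Grassmann algebra -/

section Grassmann

/-- The data of the graded algebra `E_{(m,n)}^{(u,v)}`: a decomposition `L = L_m ⊕ L_n` of a vector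
space of countably infinite dimension with `dim L_m = u` and `dim L_n = v`, given by a basis
`e₀, e₁, …` of `L` adapted to it; `deg k` is the degree of `e_k`, which is `m` if `e_k ∈ L_m` and
`n` if `e_k ∈ L_n`. -/
structure TwoInduced (F : Type*) [Field F] (L : Type*) [AddCommGroup L] [Module F L]
    (m n : ℤ) (u v : ℕ∞) where
  basis : Basis ℕ F L
  deg : ℕ → ℤ
  deg_eq : ∀ k, deg k = m ∨ deg k = n
  encard_left : {k | deg k = m}.encard = u
  encard_right : {k | deg k = n}.encard = v

variable {F : Type*} [Field F] {L : Type*} [AddCommGroup L] [Module F L]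
  {m n : ℤ} {u v : ℕ∞}

namespace TwoInduced

/-- The basis monomial `e_{i₁} ⋯ e_{i_k}` with `s = {i₁ < ⋯ < i_k}` of the Grassmann algebra
`E` of `L`. -/
def monomial (D : TwoInduced F L m n u v) (s : Finset ℕ) : ExteriorAlgebra F L :=
  D.basis.ExteriorAlgebra s

/-- The homogeneous component of degree `r`: the span of the basis monomials
`e_{i₁} ⋯ e_{i_k}` with `‖e_{i₁}‖ + ⋯ + ‖e_{i_k}‖ = r`. -/
def component (D : TwoInduced F L m n u v) (r : ℤ) : Submodule F (ExteriorAlgebra F L) :=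
  Submodule.span F (D.monomial '' {s | ∑ i ∈ s, D.deg i = r})

theorem monomial_mem (D : TwoInduced F L m n u v) (s : Finset ℕ) :
    D.monomial s ∈ D.component (∑ i ∈ s, D.deg i) :=
  Submodule.subset_span ⟨s, rfl, rfl⟩

theorem monomial_mul_mem (D : TwoInduced F L m n u v) (s t : Finset ℕ) :
    D.monomial s * D.monomial t ∈ D.component (∑ i ∈ s, D.deg i + ∑ i ∈ t, D.deg i) := by
  by_cases h : Disjoint s t
  · have e := ExteriorAlgebra.basis_mul_of_disjoint D.basis
      (⟨s, rfl⟩ : Set.powersetCard ℕ s.card) (⟨t, rfl⟩ : Set.powersetCard ℕ t.card) h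
    unfold monomial
    rw [e, ← Finset.sum_union h]
    have hm := D.monomial_mem (s ∪ t)
    rw [Units.smul_def]
    exact zsmul_mem (by simpa [monomial, Set.powersetCard.disjUnion] using hm) _
  · have e := ExteriorAlgebra.basis_mul_of_not_disjoint D.basis
      (⟨s, rfl⟩ : Set.powersetCard ℕ s.card) (⟨t, rfl⟩ : Set.powersetCard ℕ t.card) h
    unfold monomial
    rw [e]
    exact zero_mem _

instance gradedMonoid (D : TwoInduced F L m n u v) : SetLike.GradedMonoid D.component where
  one_mem := by
    have h := D.monomial_mem ∅
    have e : D.monomial ∅ = 1 := by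
      simp [monomial, ExteriorAlgebra.basis_apply_ofCard (n := 0) D.basis Finset.card_empty]
    simpa [e] using h
  mul_mem := by
    intro i j a b ha hb
    unfold component at ha hb
    induction ha, hb using Submodule.span_induction₂ with
    | mem_mem a b ha hb =>
      obtain ⟨s, rfl, rfl⟩ := ha
      obtain ⟨t, rfl, rfl⟩ := hb
      exact D.monomial_mul_mem s t
    | zero_left => simp
    | zero_right => simp
    | add_left _ _ _ _ _ _ h1 h2 => rw [add_mul]; exact add_mem h1 h2
    | add_right _ _ _ _ _ _ h1 h2 => rw [mul_add]; exact add_mem h1 h2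
    | smul_left c _ _ _ _ h => rw [smul_mul_assoc]; exact Submodule.smul_mem _ _ h
    | smul_right c _ _ _ _ h => rw [mul_smul_comm]; exact Submodule.smul_mem _ _ h

/-- The linear map sending each basis monomial to itself, placed in its degree. -/
def decomposeMap (D : TwoInduced F L m n u v) :
    ExteriorAlgebra F L →ₗ[F] DirectSum ℤ fun r => D.component r :=
  D.basis.ExteriorAlgebra.constr F fun s =>
    DirectSum.lof F ℤ (fun r => D.component r) (∑ i ∈ s, D.deg i) ⟨D.monomial s, D.monomial_mem s⟩

theorem decomposeMap_monomial (D : TwoInduced F L m n u v) (s : Finset ℕ) :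
    D.decomposeMap (D.monomial s) = DirectSum.lof F ℤ (fun r => D.component r)
      (∑ i ∈ s, D.deg i) ⟨D.monomial s, D.monomial_mem s⟩ := by
  simp only [decomposeMap, monomial, Basis.constr_basis]

instance decomposition (D : TwoInduced F L m n u v) : DirectSum.Decomposition D.component :=
  DirectSum.Decomposition.ofLinearMap D.component D.decomposeMap
    (by
      refine D.basis.ExteriorAlgebra.ext fun s => ?_
      have h := D.decomposeMap_monomial s
      unfold monomial at h
      simp [h])
    (by
      ext r ⟨y, hy⟩ : 2
      simp only [LinearMap.comp_apply, DirectSum.coeLinearMap_lof, LinearMap.id_apply]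
      unfold component at hy
      induction hy using Submodule.span_induction with
      | mem y hy =>
        obtain ⟨s, rfl, rfl⟩ := hy
        exact D.decomposeMap_monomial s
      | zero => rw [map_zero]; exact (map_zero _).symm
      | add y z hy hz h1 h2 => rw [map_add, h1, h2, ← map_add]; rfl
      | smul c y hy h => rw [map_smul, h, ← map_smul]; rfl)

/-- The Grassmann algebra with these components is a `ℤ`-graded algebra. -/
instance gradedAlgebra (D : TwoInduced F L m n u v) : GradedAlgebra D.component where

/-- The support of the grading. -/
def support (D : TwoInduced F L m n u v) : Set ℤ := {r | D.component r ≠ ⊥}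

end TwoInduced

end Grassmann

end

end GradedGrassmann

/-!
Modulo the identities of `𝔙₁` (resp. `𝔙₂`) the free algebra is spanned by normal forms: an ordered
monomial times a product of commutators in distinct variables (resp. an ordered monomial in the even
variables times a product of distinct odd variables). These normal forms are independent modulo the
identities of `E`. Substitute for each variable a sum of basis monomials with pairwise disjoint
supports: those of even length are central of square zero, so that in characteristic zero the `k`-th
power of a sum of `k` of them is nonzero and the next power vanishes; those of odd length
anticommute. Such a substitution detects a given normal form and kills the ones which come after it.

As `m < 0 < n` are coprime, every degree is attained by basis monomials avoiding any finite set of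
basis vectors. If `m n` is odd, the parity of the length of a monomial is the parity of its degree;
if `m n` is even, both parities occur in each degree, because adding `n` vectors of degree `m` and
`-m` vectors of degree `n` changes the length by the odd number `n - m`.
-/

namespace GradedGrassmann

noncomputable section

section LinearAlgebra

theorem disjoint_span_image_of_triangular {F V M κ α : Type*} [Ring F] [IsDomain F]
    [AddCommGroup V] [Module F V] [AddCommGroup M] [Module F M] [Module.IsTorsionFree F M]
    [LinearOrder α] {Q : Submodule F V} {w : κ → V} {K : Set κ} (μ : κ → α)
    (h : ∀ i ∈ K, ∃ φ : V →ₗ[F] M, Q ≤ LinearMap.ker φ ∧ φ (w i) ≠ 0 ∧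
      ∀ j ∈ K, j ≠ i → μ i ≤ μ j → φ (w j) = 0) :
    Disjoint (Submodule.span F (w '' K)) Q := by
  rw [Submodule.disjoint_def]
  intro f hf hfQ
  obtain ⟨c, hcK, rfl⟩ := (Finsupp.mem_span_image_iff_linearCombination F).1 hf
  suffices c = 0 by rw [this, map_zero]
  by_contra hc
  obtain ⟨i, hi, hmin⟩ := c.support.exists_min_image μ (Finsupp.support_nonempty_iff.2 hc)
  obtain ⟨φ, hφQ, hφi, hφj⟩ := h i (hcK hi)
  have hsum : φ (Finsupp.linearCombination F w c) = c i • φ (w i) := by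
    rw [Finsupp.linearCombination_apply, Finsupp.sum, map_sum, Finset.sum_eq_single_of_mem i hi]
    · exact map_smul ..
    · intro j hj hji
      rw [map_smul, hφj j (hcK hj) hji (hmin j hj), smul_zero]
  rw [hφQ hfQ] at hsum
  exact smul_ne_zero (Finsupp.mem_support_iff.1 hi) hφi hsum.symm

theorem span_prod_map_eq_top {F R X : Type*} [CommSemiring F] [Semiring R] [Algebra F R]
    {g : X → R} (hg : Algebra.adjoin F (Set.range g) = ⊤) :
    Submodule.span F (Set.range fun l : List X => (l.map g).prod) = ⊤ := by
  rw [← Algebra.top_toSubmodule, ← hg, Algebra.adjoin_eq_span, Submonoid.closure_eq_image_prod,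
    ← Set.range_list_map, ← Set.range_comp]
  rfl

theorem lie_add_add_of_commute {R : Type*} [Ring R] {a₀ a₁ b₀ b₁ : R} (ha : ∀ b, Commute a₀ b)
    (hb : ∀ a, Commute b₀ a) : ⁅a₀ + a₁, b₀ + b₁⁆ = ⁅a₁, b₁⁆ := by
  let _ : LieRing R := LieRing.ofAssociativeRing
  rw [add_lie, lie_add, lie_add, (ha b₀).lie_eq, (ha b₁).lie_eq, (hb a₁).symm.lie_eq, zero_add,
    zero_add, zero_add]

theorem lie_lie_eq_zero_of_span_eq_top {F R : Type*} [CommRing F] [Ring R] [Algebra F R]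
    {S : Set R} (hS : Submodule.span F S = ⊤)
    (h : ∀ a ∈ S, ∀ b ∈ S, ∀ c ∈ S, ⁅⁅a, b⁆, c⁆ = 0) (a b c : R) : ⁅⁅a, b⁆, c⁆ = 0 := by
  let _ : LieRing R := LieRing.ofAssociativeRing
  have hmem (r : R) : r ∈ Submodule.span F S := hS ▸ Submodule.mem_top
  induction hmem a using Submodule.span_induction with
  | zero => simp
  | add a a' _ _ ha ha' => rw [add_lie, add_lie, ha, ha', add_zero]
  | smul r a _ ha => rw [smul_lie, smul_lie, ha, smul_zero]
  | mem a ha =>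
  induction hmem b using Submodule.span_induction with
  | zero => simp
  | add b b' _ _ hb hb' => rw [lie_add, add_lie, hb, hb', add_zero]
  | smul r b _ hb => rw [lie_smul, smul_lie, hb, smul_zero]
  | mem b hb =>
  induction hmem c using Submodule.span_induction with
  | zero => simp
  | add c c' _ _ hc hc' => rw [lie_add, hc, hc', add_zero]
  | smul r c _ hc => rw [lie_smul, hc, smul_zero]
  | mem c hc => exact h a ha b hb c hc

end LinearAlgebra

section Lists

variable {α β : Type*}

theorem rel_of_perm_of_swap (S : Setoid β) (f : List α → β) {l k : List α} (hlk : l.Perm k)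
    (h : ∀ (p m : List α) (a b : α), (p ++ a :: b :: m).Perm l →
      S (f (p ++ a :: b :: m)) (f (p ++ b :: a :: m))) :
    S (f l) (f k) := by
  suffices ∀ q : List α, (∀ (p m : List α) (a b : α), (p ++ a :: b :: m).Perm (q ++ l) →
      S (f (p ++ a :: b :: m)) (f (p ++ b :: a :: m))) → S (f (q ++ l)) (f (q ++ k)) from
    this [] h
  clear h
  induction hlk with
  | nil => exact fun q _ => S.refl _
  | cons a _ ih => exact fun q h => by simpa using ih (q ++ [a]) (by simpa using h)
  | swap a b l => exact fun q h => h q l b a (List.Perm.refl _)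
  | trans hlk _ ih ih' =>
    exact fun q h => S.trans (ih q h)
      (ih' q fun p m a b hp => h p m a b (hp.trans (hlk.symm.append_left q)))

theorem exists_smul_eq_of_perm_of_swap {G : Type*} [Group G] [MulAction G β] (f : List α → β)
    {l k : List α} (hlk : l.Perm k)
    (h : ∀ (p m : List α) (a b : α), ∃ ε : G, f (p ++ a :: b :: m) = ε • f (p ++ b :: a :: m)) :
    ∃ ε : G, f l = ε • f k := by
  obtain ⟨ε, hε⟩ := rel_of_perm_of_swap (MulAction.orbitRel G β) f hlk fun p m a b _ =>
    (h p m a b).imp fun _ => Eq.symm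
  exact ⟨ε, hε.symm⟩

theorem exists_perm_cons_cons_of_not_nodup {l : List α} (h : ¬ l.Nodup) :
    ∃ (a : α) (k : List α), l.Perm (a :: a :: k) := by
  obtain ⟨a, ha⟩ := List.exists_duplicate_iff_not_nodup.2 h
  obtain ⟨k, hk⟩ := (List.duplicate_iff_sublist.1 ha).exists_perm_append
  exact ⟨a, k, hk⟩

end Lists

section NormalForms

variable {X R : Type*} [Ring R]

/-- The product `[a₁, a₂] [a₃, a₄] ⋯` of the commutators of consecutive pairs of entries of a list,
with value zero on the lists of odd length. -/
def commutatorProd : List R → R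
  | [] => 1
  | [_] => 0
  | a :: b :: l => ⁅a, b⁆ * commutatorProd l

theorem commutatorProd_of_odd_length : ∀ l : List R, Odd l.length → commutatorProd l = 0
  | [], h => by simp at h
  | [_], _ => rfl
  | _ :: _ :: l, h => by
    rw [commutatorProd, commutatorProd_of_odd_length l (by simpa [Nat.odd_add_one] using h),
      mul_zero]

theorem map_commutatorProd {S G : Type*} [Ring S] [FunLike G R S] [RingHomClass G R S] (φ : G) :
    ∀ l : List R, φ (commutatorProd l) = commutatorProd (l.map φ)
  | [] => map_one φ
  | [_] => map_zero φ
  | a :: b :: l => by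
    simp only [commutatorProd, Ring.lie_def, List.map_cons, map_mul, map_sub,
      map_commutatorProd φ l]

theorem lie_mul_lie_swap (H : ∀ a b c : R, ⁅⁅a, b⁆, c⁆ = 0) (a b c d : R) :
    ⁅a, b⁆ * ⁅c, d⁆ = -(⁅a, c⁆ * ⁅b, d⁆) := by
  have hcomm : Commute ⁅a, c⁆ ⁅b, d⁆ := commute_iff_lie_eq.2 (H _ _ _)
  rw [hcomm.eq, eq_neg_iff_add_eq_zero]
  calc ⁅a, b⁆ * ⁅c, d⁆ + ⁅b, d⁆ * ⁅a, c⁆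
      = ⁅⁅a, b * c⁆, d⁆ - ⁅⁅a, b⁆, d⁆ * c - b * ⁅⁅a, c⁆, d⁆ := by
        simp only [Ring.lie_def]; noncomm_ring
    _ = 0 := by simp only [H, zero_mul, mul_zero, sub_zero]

theorem commutatorProd_swap (H : ∀ a b c : R, ⁅⁅a, b⁆, c⁆ = 0) (a b : R) (l : List R) :
    ∀ p : List R, commutatorProd (p ++ a :: b :: l) = -commutatorProd (p ++ b :: a :: l)
  | [] => by simp only [List.nil_append, commutatorProd, Ring.lie_def]; noncomm_ring
  | [c] => by
    cases l with
    | nil => simp [commutatorProd]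
    | cons d l =>
      simp only [List.cons_append, List.nil_append, commutatorProd, ← mul_assoc]
      rw [lie_mul_lie_swap H c a b d, neg_mul]
  | c :: d :: p => by
    simp only [List.cons_append, commutatorProd, commutatorProd_swap H a b l p, mul_neg]

theorem exists_commutatorProd_eq_smul_of_perm (H : ∀ a b c : R, ⁅⁅a, b⁆, c⁆ = 0) {l k : List R}
    (hlk : l.Perm k) : ∃ ε : ℤˣ, commutatorProd l = ε • commutatorProd k :=
  exists_smul_eq_of_perm_of_swap _ hlk fun p m a b =>
    ⟨-1, by rw [commutatorProd_swap H, Units.neg_smul, one_smul]⟩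

theorem commutatorProd_map_eq_zero_of_not_nodup (H : ∀ a b c : R, ⁅⁅a, b⁆, c⁆ = 0) (g : X → R)
    {l : List X} (hl : ¬ l.Nodup) : commutatorProd (l.map g) = 0 := by
  obtain ⟨a, k, hk⟩ := exists_perm_cons_cons_of_not_nodup hl
  obtain ⟨ε, hε⟩ := exists_commutatorProd_eq_smul_of_perm H (hk.map g)
  simp [hε, commutatorProd, Ring.lie_def]

/-- The product of a monomial `x₁ x₂ ⋯` in the variables of a multiset with the value of `c`, a
product of variables or of commutators, on the variables of a finite set. The order of the variables
is an arbitrary one. -/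
def normalForm (g : X → R) (c : List R → R) (i : Multiset X × Finset X) : R :=
  (i.1.toList.map g).prod * c (i.2.toList.map g)

theorem map_normalForm {S G : Type*} [Ring S] [FunLike G R S] [MonoidHomClass G R S] {φ : G}
    (g : X → R) {c : List R → R} {c' : List S → S} (hc : ∀ l, φ (c l) = c' (l.map φ))
    (i : Multiset X × Finset X) : φ (normalForm g c i) = normalForm (φ ∘ g) c' i := by
  simp only [normalForm, map_mul, map_list_prod, hc, List.map_map]

variable {F : Type*} [CommRing F] [Algebra F R]

theorem prod_toList_mul_commutatorProd_mem_span (H : ∀ a b c : R, ⁅⁅a, b⁆, c⁆ = 0) (g : X → R)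
    (s : Multiset X) (t : List X) : (s.toList.map g).prod * commutatorProd (t.map g) ∈
      Submodule.span F (normalForm g commutatorProd '' {i | Even i.2.card}) := by
  classical
  by_cases ht : t.Nodup
  · rcases Nat.even_or_odd t.length with he | ho
    · obtain ⟨ε, hε⟩ :=
        exists_commutatorProd_eq_smul_of_perm H ((List.toFinset_toList ht).symm.map g)
      rw [hε, mul_smul_comm, Units.smul_def]
      refine zsmul_mem (Submodule.subset_span ?_) _
      exact ⟨(s, t.toFinset), by rwa [Set.mem_ofPred, List.toFinset_card_of_nodup ht], rfl⟩
    · rw [commutatorProd_of_odd_length _ (by simpa using ho), mul_zero]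
      exact zero_mem _
  · rw [commutatorProd_map_eq_zero_of_not_nodup H g ht, mul_zero]
    exact zero_mem _

theorem prod_mul_commutatorProd_mem_span (H : ∀ a b c : R, ⁅⁅a, b⁆, c⁆ = 0) (g : X → R)
    (l t : List X) : (l.map g).prod * commutatorProd (t.map g) ∈
      Submodule.span F (normalForm g commutatorProd '' {i | Even i.2.card}) := by
  classical
  set N := Submodule.span F (normalForm g commutatorProd '' {i | Even i.2.card})
  induction hr : l.length using Nat.strong_induction_on generalizing l t with
  | _ r ih =>
    have hsort : (l.map g).prod * commutatorProd (t.map g) -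
        ((l : Multiset X).toList.map g).prod * commutatorProd (t.map g) ∈ N := by
      rw [← Submodule.quotientRel_def]
      refine rel_of_perm_of_swap N.quotientRel
        (fun l => (l.map g).prod * commutatorProd (t.map g))
        (Multiset.coe_eq_coe.1 (Multiset.coe_toList (l : Multiset X)).symm) fun p m a b hp => ?_
      rw [Submodule.quotientRel_def]
      have hlen := hp.length_eq
      simp only [List.length_append, List.length_cons] at hlen
      have hmem := ih (p ++ m).length (by simp; omega) (p ++ m) (a :: b :: t) rfl
      have hcomm : (m.map g).prod * ⁅g a, g b⁆ = ⁅g a, g b⁆ * (m.map g).prod :=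
        (commute_iff_lie_eq.2 (H _ _ _)).eq.symm
      convert hmem using 1
      simp only [List.map_append, List.map_cons, List.prod_append, List.prod_cons, commutatorProd,
        mul_assoc, ← mul_assoc (m.map g).prod, hcomm]
      simp only [Ring.lie_def]
      noncomm_ring
    exact (Submodule.sub_mem_iff_left N (prod_toList_mul_commutatorProd_mem_span H g l t)).1 hsort

theorem span_normalForm_commutatorProd (H : ∀ a b c : R, ⁅⁅a, b⁆, c⁆ = 0) {g : X → R}
    (hg : Algebra.adjoin F (Set.range g) = ⊤) :
    Submodule.span F (normalForm g commutatorProd '' {i | Even i.2.card}) = ⊤ := by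
  rw [← top_le_iff, ← span_prod_map_eq_top hg, Submodule.span_le]
  rintro _ ⟨l, rfl⟩
  simpa [commutatorProd] using prod_mul_commutatorProd_mem_span (F := F) H g l []

theorem exists_prod_map_eq_smul_of_perm {g : X → R}
    (hswap : ∀ a b, ∃ ε : ℤˣ, g a * g b = ε • (g b * g a)) {l k : List X} (hlk : l.Perm k) :
    ∃ ε : ℤˣ, (l.map g).prod = ε • (k.map g).prod := by
  refine exists_smul_eq_of_perm_of_swap (fun l => (l.map g).prod) hlk fun p m a b => ?_
  obtain ⟨ε, hε⟩ := hswap a b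
  refine ⟨ε, ?_⟩
  simp only [List.map_append, List.map_cons, List.prod_append, List.prod_cons]
  rw [← mul_assoc (g a), hε, smul_mul_assoc, mul_smul_comm, mul_assoc (g b)]

theorem prod_map_eq_zero_of_not_nodup {g : X → R} {l : List X} (hl : ¬ l.Nodup)
    (hswap : ∀ a b, ∃ ε : ℤˣ, g a * g b = ε • (g b * g a)) (hsq : ∀ a ∈ l, g a * g a = 0) :
    (l.map g).prod = 0 := by
  obtain ⟨a, k, hk⟩ := exists_perm_cons_cons_of_not_nodup hl
  obtain ⟨ε, hε⟩ := exists_prod_map_eq_smul_of_perm hswap hk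
  rw [hε, List.map_cons, List.map_cons, List.prod_cons, List.prod_cons, ← mul_assoc,
    hsq a (hk.symm.subset List.mem_cons_self), zero_mul, smul_zero]

theorem span_normalForm_prod {g : X → R} (hg : Algebra.adjoin F (Set.range g) = ⊤) (O : Set X)
    (hswap : ∀ a b, ∃ ε : ℤˣ, g a * g b = ε • (g b * g a)) (hsq : ∀ a ∈ O, g a * g a = 0) :
    Submodule.span F (normalForm g List.prod '' {i | (∀ a ∈ i.1, a ∉ O) ∧ ∀ a ∈ i.2, a ∈ O}) =
      ⊤ := by
  classical
  rw [← top_le_iff, ← span_prod_map_eq_top hg, Submodule.span_le]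
  rintro _ ⟨l, rfl⟩
  set e := l.filter (· ∉ O)
  set o := l.filter (· ∈ O)
  have hsort : l.Perm ((e : Multiset X).toList ++ o) := by
    have he : (e : Multiset X).toList.Perm e := Multiset.coe_eq_coe.1 (Multiset.coe_toList _)
    refine ((he.append_right o).trans (List.perm_append_comm.trans ?_)).symm
    simpa [e, o] using List.filter_append_perm (· ∈ O) l
  obtain ⟨ε, hε⟩ := exists_prod_map_eq_smul_of_perm hswap hsort
  simp only [hε, List.map_append, List.prod_append, Units.smul_def, SetLike.mem_coe]
  refine zsmul_mem ?_ _
  by_cases ho : o.Nodup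
  · obtain ⟨δ, hδ⟩ := exists_prod_map_eq_smul_of_perm hswap (List.toFinset_toList ho).symm
    rw [hδ, mul_smul_comm, Units.smul_def]
    refine zsmul_mem (Submodule.subset_span ?_) _
    exact ⟨(e, o.toFinset), by simp [e, o], rfl⟩
  · rw [prod_map_eq_zero_of_not_nodup ho hswap fun a ha => hsq a (by simpa [o] using
      (List.mem_filter.1 ha).2), mul_zero]
    exact zero_mem _

end NormalForms

section SeparatingSubstitution

variable {X C A : Type*} [DecidableEq X] [CommRing C] [Ring A] [Algebra C A]

variable (C A) in
/-- A substitution `x ↦ even x + odd x` of the variables, with central even parts and anticommuting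
odd parts, which detects the normal form of index `(s, T)`: its value at that normal form is a
multiple of the product of the `even x` for `x ∈ s` and the `odd x` for `x ∈ T`, while it kills the
normal forms of the other indices which have at least as many factors. -/
structure SeparatingSubstitution (s : Multiset X) (T : Finset X) where
  even : X → C
  odd : X → A
  odd_mul_odd : ∀ x y, odd x * odd y = -(odd y * odd x)
  odd_mul_self : ∀ x, odd x * odd x = 0
  odd_eq_zero : ∀ x ∉ T, odd x = 0
  even_pow_eq_zero : ∀ x, even x ^ (s.count x + 1) = 0
  top_ne_zero : (s.map even).prod • (T.toList.map odd).prod ≠ 0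

namespace SeparatingSubstitution

variable {s s' : Multiset X} {T T' : Finset X} (σ : SeparatingSubstitution C A s T)

/-- The substitution `x ↦ even x + odd x` itself. -/
def toFun (x : X) : A := algebraMap C A (σ.even x) + σ.odd x

theorem toFun_eq_odd {x : X} (hx : x ∉ s) : σ.toFun x = σ.odd x := by
  have h := σ.even_pow_eq_zero x
  rw [Multiset.count_eq_zero.2 hx, zero_add, pow_one] at h
  rw [toFun, h, map_zero, zero_add]

theorem odd_mul_prod_eq_zero_of_mem {x : X} {t : List X} (hx : x ∈ t) :
    σ.odd x * (t.map σ.odd).prod = 0 := by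
  induction t with
  | nil => simp at hx
  | cons y t ih =>
    rw [List.map_cons, List.prod_cons, ← mul_assoc]
    rcases List.mem_cons.1 hx with rfl | hx
    · rw [σ.odd_mul_self, zero_mul]
    · rw [σ.odd_mul_odd, neg_mul, mul_assoc, ih hx, mul_zero, neg_zero]

theorem prod_odd_eq_zero (h : ¬ T' ⊆ T) : (T'.toList.map σ.odd).prod = 0 := by
  obtain ⟨x, hx, hxT⟩ := Finset.not_subset.1 h
  exact List.prod_eq_zero (List.mem_map.2 ⟨x, Finset.mem_toList.2 hx, σ.odd_eq_zero x hxT⟩)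

theorem prod_even_eq_zero {x : X} (hx : s.count x < s'.count x) : (s'.map σ.even).prod = 0 := by
  rw [Finset.prod_multiset_map_count]
  exact Finset.prod_eq_zero (Multiset.mem_toFinset.2 (Multiset.count_pos.1 (Nat.zero_lt_of_lt hx)))
    (pow_eq_zero_of_le hx (σ.even_pow_eq_zero x))

theorem odd_mul_prod_eq_zero (hT : T.card ≤ T'.card) (x : X) :
    σ.odd x * (T'.toList.map σ.odd).prod = 0 := by
  by_cases hsub : T' ⊆ T
  · obtain rfl := Finset.eq_of_subset_of_card_le hsub hT
    by_cases hx : x ∈ T'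
    · exact σ.odd_mul_prod_eq_zero_of_mem (Finset.mem_toList.2 hx)
    · rw [σ.odd_eq_zero x hx, zero_mul]
  · rw [σ.prod_odd_eq_zero hsub, mul_zero]

theorem prod_toFun_mul {a : A} (ha : ∀ x, σ.odd x * a = 0) (l : List X) :
    (l.map σ.toFun).prod * a = (l.map σ.even).prod • a := by
  induction l with
  | nil => simp
  | cons x l ih =>
    rw [List.map_cons, List.prod_cons, List.map_cons, List.prod_cons, mul_assoc, ih, toFun, add_mul,
      mul_smul_comm (_ : C) (σ.odd x), ha, smul_zero, add_zero, ← Algebra.smul_def, smul_smul]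

theorem normalForm_toFun (hT : T.card ≤ T'.card) {c : List A → A} {r : ℕ}
    (hc : c (T'.toList.map σ.toFun) = r • (T'.toList.map σ.odd).prod) :
    normalForm σ.toFun c (s', T') = r • (s'.map σ.even).prod • (T'.toList.map σ.odd).prod := by
  rw [normalForm, hc, mul_smul_comm, σ.prod_toFun_mul (σ.odd_mul_prod_eq_zero hT),
    ← Multiset.prod_coe, ← Multiset.map_coe, Multiset.coe_toList]

theorem normalForm_toFun_ne_zero [IsAddTorsionFree A] {c : List A → A} {r : ℕ} (hr : r ≠ 0)
    (hc : c (T.toList.map σ.toFun) = r • (T.toList.map σ.odd).prod) :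
    normalForm σ.toFun c (s, T) ≠ 0 := by
  rw [σ.normalForm_toFun le_rfl hc]
  exact smul_ne_zero hr σ.top_ne_zero

theorem normalForm_toFun_eq_zero {c : List A → A} {r : ℕ}
    (hc : c (T'.toList.map σ.toFun) = r • (T'.toList.map σ.odd).prod) (hne : (s', T') ≠ (s, T))
    (hle : toLex (T.card, s.card) ≤ toLex (T'.card, s'.card)) :
    normalForm σ.toFun c (s', T') = 0 := by
  rw [Prod.Lex.toLex_le_toLex] at hle
  have hT : T.card ≤ T'.card := hle.elim le_of_lt fun h => h.1.le
  rw [σ.normalForm_toFun hT hc]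
  by_cases hsub : T' ⊆ T
  · obtain rfl := Finset.eq_of_subset_of_card_le hsub hT
    have hcard : s.card ≤ s'.card := by simpa using hle
    obtain ⟨x, hx⟩ : ∃ x, s.count x < s'.count x := by
      by_contra! hcount
      exact hne (by rw [Multiset.eq_of_le_of_card_le (Multiset.le_iff_count.2 hcount) hcard])
    rw [σ.prod_even_eq_zero hx, zero_smul, smul_zero]
  · rw [σ.prod_odd_eq_zero hsub, smul_zero, smul_zero]

theorem lie_toFun (x y : X) : ⁅σ.toFun x, σ.toFun y⁆ = 2 • (σ.odd x * σ.odd y) := by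
  rw [toFun, toFun, lie_add_add_of_commute (Algebra.commute_algebraMap_left _)
    (Algebra.commute_algebraMap_left _), Ring.lie_def, σ.odd_mul_odd y x, sub_neg_eq_add, two_smul]

theorem commutatorProd_toFun : ∀ {t : List X}, Even t.length →
    commutatorProd (t.map σ.toFun) = 2 ^ (t.length / 2) • (t.map σ.odd).prod
  | [], _ => by simp [commutatorProd]
  | [_], h => by simp at h
  | x :: y :: t, h => by
    have ih := commutatorProd_toFun (t := t) (by simpa [Nat.even_add_one] using h)
    have hlen : (x :: y :: t).length / 2 = t.length / 2 + 1 := by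
      simp only [List.length_cons]; omega
    simp only [hlen, List.map_cons, commutatorProd, List.prod_cons]
    rw [σ.lie_toFun, ih, smul_mul_smul_comm, pow_succ', mul_assoc]

end SeparatingSubstitution

end SeparatingSubstitution

section TIdeals

variable {F : Type*} [Field F] {A : Type*} [Ring A] [Algebra F A]

theorem mkₐ_eq_zero_iff {I : TwoSidedIdeal (FreeGr F)} {f : FreeGr F} :
    I.ringCon.mkₐ F f = 0 ↔ f ∈ I :=
  (RingCon.eq I.ringCon).trans (I.mem_iff f).symm

theorem adjoin_range_mkₐ_comp_ι (I : TwoSidedIdeal (FreeGr F)) :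
    Algebra.adjoin F (Set.range (I.ringCon.mkₐ F ∘ FreeAlgebra.ι F)) = ⊤ := by
  rw [Set.range_comp, ← AlgHom.map_adjoin, FreeAlgebra.adjoin_range_ι, Algebra.map_top,
    RingCon.range_mkₐ]

theorem gradedIdentities_eq_of_triangular (𝒜 : ℤ → Submodule F A) [GradedAlgebra 𝒜]
    {I : TwoSidedIdeal (FreeGr F)} (hI : I ≤ gradedIdentities 𝒜) {κ α : Type*} [LinearOrder α]
    {w : κ → FreeGr F} {K : Set κ} (μ : κ → α)
    (hspan : Submodule.span F ((I.ringCon.mkₐ F ∘ w) '' K) = ⊤)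
    (hsep : ∀ i ∈ K, ∃ a : ℤ × ℕ → A, (∀ p, a p ∈ 𝒜 p.1) ∧ FreeAlgebra.lift F a (w i) ≠ 0 ∧
      ∀ j ∈ K, j ≠ i → μ i ≤ μ j → FreeAlgebra.lift F a (w j) = 0) :
    gradedIdentities 𝒜 = I := by
  refine le_antisymm (fun f hf => ?_) hI
  have hdisj : Disjoint (Submodule.span F (w '' K))
      ((gradedIdentities 𝒜).asIdeal.restrictScalars F) := by
    refine disjoint_span_image_of_triangular (M := A) μ fun i hi => ?_
    obtain ⟨a, ha, hai, haj⟩ := hsep i hi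
    exact ⟨(FreeAlgebra.lift F a).toLinearMap,
      fun g hg => (mem_gradedIdentities 𝒜 g).1 (TwoSidedIdeal.mem_asIdeal.1 hg) a ha, hai, haj⟩
  obtain ⟨g, hg, hgf⟩ : I.ringCon.mkₐ F f ∈
      (Submodule.span F (w '' K)).map (I.ringCon.mkₐ F).toLinearMap := by
    rw [Submodule.map_span, ← Set.image_comp]
    exact hspan ▸ Submodule.mem_top
  have hfg : f - g ∈ I := mkₐ_eq_zero_iff.1 (by rw [map_sub, sub_eq_zero]; exact hgf.symm)
  have hgid : g ∈ gradedIdentities 𝒜 := by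
    simpa using (gradedIdentities 𝒜).sub_mem hf (hI hfg)
  have hg0 : g = 0 := Submodule.disjoint_def.1 hdisj g hg (TwoSidedIdeal.mem_asIdeal.2 hgid)
  rwa [hg0, sub_zero] at hfg

theorem word_mem_freeComponent (l : List (ℤ × ℕ)) :
    (l.map (FreeAlgebra.ι F)).prod ∈ freeComponent F (l.map Prod.fst).sum :=
  Submodule.subset_span ⟨l, rfl, rfl⟩

theorem ι_mem_freeComponent (p : ℤ × ℕ) : FreeAlgebra.ι F p ∈ freeComponent F p.1 := by
  simpa using word_mem_freeComponent (F := F) [p]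

instance freeComponent_gradedMonoid : SetLike.GradedMonoid (freeComponent F) where
  one_mem := word_mem_freeComponent []
  mul_mem i j f g hf hg := by
    have hle : freeComponent F i * freeComponent F j ≤ freeComponent F (i + j) := by
      rw [freeComponent, freeComponent, Submodule.span_mul_span, Submodule.span_le,
        Set.mul_subset_iff]
      rintro _ ⟨k, rfl, rfl⟩ _ ⟨l, rfl, rfl⟩
      simpa using word_mem_freeComponent (F := F) (k ++ l)
    exact hle (Submodule.mul_mem_mul hf hg)

theorem lift_mem_of_mem_freeComponent (𝒜 : ℤ → Submodule F A) [SetLike.GradedMonoid 𝒜]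
    {a : ℤ × ℕ → A} (ha : ∀ p, a p ∈ 𝒜 p.1) {i : ℤ} {f : FreeGr F} (hf : f ∈ freeComponent F i) :
    FreeAlgebra.lift F a f ∈ 𝒜 i := by
  have hle : freeComponent F i ≤ (𝒜 i).comap (FreeAlgebra.lift F a).toLinearMap := by
    rw [freeComponent, Submodule.span_le]
    rintro _ ⟨l, rfl, rfl⟩
    simpa [map_list_prod, Function.comp_def] using
      SetLike.list_prod_map_mem_graded l Prod.fst a fun p _ => ha p
  exact hle hf

theorem isTIdeal_gradedIdentities (𝒜 : ℤ → Submodule F A) [GradedAlgebra 𝒜] :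
    IsTIdeal (gradedIdentities 𝒜) := by
  intro φ hφ f hf
  rw [mem_gradedIdentities] at hf ⊢
  intro a ha
  have hcomp : (FreeAlgebra.lift F a).comp φ =
      FreeAlgebra.lift F fun p => FreeAlgebra.lift F a (φ (FreeAlgebra.ι F p)) := by
    ext p; simp
  rw [← AlgHom.comp_apply, hcomp]
  exact hf _ fun p => lift_mem_of_mem_freeComponent 𝒜 ha (hφ _ _ (ι_mem_freeComponent p))

theorem subset_tIdealSpan {S : Set (FreeGr F)} {f : FreeGr F} (hf : f ∈ S) : f ∈ tIdealSpan S := by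
  rw [tIdealSpan, TwoSidedIdeal.mem_sInf]
  exact fun I hI => hI.2 f hf

theorem isTIdeal_tIdealSpan (S : Set (FreeGr F)) : IsTIdeal (tIdealSpan S) := by
  intro φ hφ f hf
  rw [tIdealSpan, TwoSidedIdeal.mem_sInf] at hf ⊢
  exact fun I hI => hI.1 φ hφ f (hf I hI)

theorem lift_mem_tIdealSpan {S : Set (FreeGr F)} {a : ℤ × ℕ → FreeGr F}
    (ha : ∀ p, a p ∈ freeComponent F p.1) {f : FreeGr F} (hf : f ∈ S) :
    FreeAlgebra.lift F a f ∈ tIdealSpan S :=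
  isTIdeal_tIdealSpan S _ (fun _ _ => lift_mem_of_mem_freeComponent (freeComponent F) ha) _
    (subset_tIdealSpan hf)

theorem tIdealSpan_le_gradedIdentities {𝒜 : ℤ → Submodule F A} [GradedAlgebra 𝒜]
    {S : Set (FreeGr F)} (h : ∀ f ∈ S, f ∈ gradedIdentities 𝒜) :
    tIdealSpan S ≤ gradedIdentities 𝒜 :=
  sInf_le ⟨isTIdeal_gradedIdentities 𝒜, h⟩

theorem lie_lie_mem_tIdealSpan_definingV1 {i j l : ℤ} {f g h : FreeGr F}
    (hf : f ∈ freeComponent F i) (hg : g ∈ freeComponent F j) (hh : h ∈ freeComponent F l) :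
    ⁅⁅f, g⁆, h⁆ ∈ tIdealSpan (definingV1 F) := by
  let a : ℤ × ℕ → FreeGr F := fun p =>
    if p = (i, 0) then f else if p = (j, 1) then g else if p = (l, 2) then h
    else FreeAlgebra.ι F p
  have ha (p) : a p ∈ freeComponent F p.1 := by
    simp only [a]
    split_ifs with hi hj hl
    · rwa [hi]
    · rwa [hj]
    · rwa [hl]
    · exact ι_mem_freeComponent p
  have hmem := lift_mem_tIdealSpan ha
    (show ⁅⁅x F i 0, x F j 1⁆, x F l 2⁆ ∈ definingV1 F from ⟨i, j, l, 0, 1, 2, rfl⟩)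
  simpa [Ring.lie_def, a] using hmem

theorem lie_lie_eq_zero_of_tIdealSpan_definingV1
    (a b c : (tIdealSpan (definingV1 F)).ringCon.Quotient) : ⁅⁅a, b⁆, c⁆ = 0 := by
  refine lie_lie_eq_zero_of_span_eq_top
    (span_prod_map_eq_top (adjoin_range_mkₐ_comp_ι (tIdealSpan (definingV1 F)))) ?_ a b c
  rintro _ ⟨k, rfl⟩ _ ⟨l, rfl⟩ _ ⟨r, rfl⟩
  have h := mkₐ_eq_zero_iff.2 (lie_lie_mem_tIdealSpan_definingV1
    (word_mem_freeComponent (F := F) k) (word_mem_freeComponent l) (word_mem_freeComponent r))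
  simpa only [Ring.lie_def, map_sub, map_mul, map_list_prod, List.map_map] using h

end TIdeals

section SquareZero

variable {C : Type*} [CommRing C]

theorem add_pow_succ_of_mul_self_eq_zero {a : C} (ha : a * a = 0) (y : C) (k : ℕ) :
    (a + y) ^ (k + 1) = y ^ (k + 1) + (k + 1) * (a * y ^ k) := by
  induction k with
  | zero => simp [add_comm]
  | succ k ih =>
    rw [pow_succ, ih]
    push_cast
    linear_combination ((k : C) + 1) * y ^ k * ha

theorem sum_pow_card_add_one_of_mul_self_eq_zero {ι : Type*} {P : Finset ι} {w : ι → C}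
    (hw : ∀ i ∈ P, w i * w i = 0) : (∑ i ∈ P, w i) ^ (P.card + 1) = 0 := by
  induction P using Finset.cons_induction with
  | empty => simp
  | cons a P ha ih =>
    have hP := ih fun i hi => hw i (Finset.mem_cons_of_mem hi)
    rw [Finset.sum_cons, add_pow_succ_of_mul_self_eq_zero (hw a (Finset.mem_cons_self a P)),
      Finset.card_cons, hP, pow_succ, hP, zero_mul, mul_zero, mul_zero, add_zero]

theorem sum_pow_card_of_mul_self_eq_zero {ι : Type*} {P : Finset ι} {w : ι → C}
    (hw : ∀ i ∈ P, w i * w i = 0) :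
    (∑ i ∈ P, w i) ^ P.card = P.card.factorial * ∏ i ∈ P, w i := by
  induction P using Finset.cons_induction with
  | empty => simp
  | cons a P ha ih =>
    have hP : ∀ i ∈ P, w i * w i = 0 := fun i hi => hw i (Finset.mem_cons_of_mem hi)
    rw [Finset.sum_cons, Finset.card_cons,
      add_pow_succ_of_mul_self_eq_zero (hw a (Finset.mem_cons_self a P)),
      sum_pow_card_add_one_of_mul_self_eq_zero hP, ih hP, Finset.prod_cons, Nat.factorial_succ]
    push_cast
    ring

open Finset in
theorem prod_map_sum_of_mul_self_eq_zero {X : Type*} [DecidableEq X] {s : Multiset X}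
    {w : (Σ x, Fin (s.count x)) → C} (hw : ∀ p, w p * w p = 0) :
    (s.map fun x => ∑ j, w ⟨x, j⟩).prod =
      (∏ x ∈ s.toFinset, (s.count x).factorial : ℕ) •
        ∏ p ∈ s.toFinset.sigma fun _ => univ, w p := by
  rw [prod_multiset_map_count, prod_sigma, nsmul_eq_mul, Nat.cast_prod, ← prod_mul_distrib]
  refine prod_congr rfl fun x _ => ?_
  simpa using sum_pow_card_of_mul_self_eq_zero (P := univ) (w := fun j => w ⟨x, j⟩) fun j _ => hw _

end SquareZero

section ExteriorAlgebra

variable {R M : Type*} [CommRing R] [AddCommGroup M] [Module R M] {a b : ExteriorAlgebra R M}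

open CliffordAlgebra

theorem mul_eq_smul_mul_of_mem_evenOdd {i j : ZMod 2} (ha : a ∈ evenOdd (0 : QuadraticForm R M) i)
    (hb : b ∈ evenOdd (0 : QuadraticForm R M) j) : a * b = (-1 : ℤˣ) ^ (j * i) • (b * a) := by
  simpa only [map_id, AlgHom.id_apply] using
    map_mul_map_of_isOrtho_of_mem_evenOdd (QuadraticMap.Isometry.id (0 : QuadraticForm R M))
      (QuadraticMap.Isometry.id 0) (fun _ _ => QuadraticMap.isOrtho_def.2 (by simp)) a b ha hb

theorem mul_eq_neg_mul_of_mem_evenOdd_one (ha : a ∈ evenOdd (0 : QuadraticForm R M) 1)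
    (hb : b ∈ evenOdd (0 : QuadraticForm R M) 1) : a * b = -(b * a) := by
  simpa using mul_eq_smul_mul_of_mem_evenOdd ha hb

theorem mul_mem_evenOdd_zero (ha : a ∈ evenOdd (0 : QuadraticForm R M) 1)
    (hb : b ∈ evenOdd (0 : QuadraticForm R M) 1) : a * b ∈ evenOdd (0 : QuadraticForm R M) 0 := by
  have h : (1 + 1 : ZMod 2) = 0 := rfl
  exact h ▸ evenOdd_mul_le (0 : QuadraticForm R M) 1 1 (Submodule.mul_mem_mul ha hb)

theorem exists_add_eq_of_evenOdd (a : ExteriorAlgebra R M) :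
    ∃ a₀ a₁ : ExteriorAlgebra R M, a₀ ∈ evenOdd (0 : QuadraticForm R M) 0 ∧
      a₁ ∈ evenOdd (0 : QuadraticForm R M) 1 ∧ a₀ + a₁ = a := by
  obtain ⟨a₀, h₀, a₁, h₁, h⟩ := Submodule.mem_sup.1
    ((evenOdd_isCompl (0 : QuadraticForm R M)).sup_eq_top ▸ Submodule.mem_top (x := a))
  exact ⟨a₀, a₁, h₀, h₁, h⟩

theorem commute_of_mem_evenOdd_zero (ha : a ∈ evenOdd (0 : QuadraticForm R M) 0)
    (b : ExteriorAlgebra R M) : Commute a b := by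
  obtain ⟨b₀, b₁, hb₀, hb₁, rfl⟩ := exists_add_eq_of_evenOdd b
  refine Commute.add_right ?_ ?_
  · simpa [commute_iff_eq] using mul_eq_smul_mul_of_mem_evenOdd ha hb₀
  · simpa [commute_iff_eq] using mul_eq_smul_mul_of_mem_evenOdd ha hb₁

theorem mem_center_of_mem_evenOdd_zero (ha : a ∈ evenOdd (0 : QuadraticForm R M) 0) :
    a ∈ Subring.center (ExteriorAlgebra R M) :=
  Subring.mem_center_iff.2 fun b => (commute_of_mem_evenOdd_zero ha b).eq.symm

theorem lie_mem_evenOdd_zero (a b : ExteriorAlgebra R M) :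
    (⁅a, b⁆ : ExteriorAlgebra R M) ∈ evenOdd (0 : QuadraticForm R M) 0 := by
  obtain ⟨a₀, a₁, ha₀, ha₁, rfl⟩ := exists_add_eq_of_evenOdd a
  obtain ⟨b₀, b₁, hb₀, hb₁, rfl⟩ := exists_add_eq_of_evenOdd b
  rw [lie_add_add_of_commute (commute_of_mem_evenOdd_zero ha₀) (commute_of_mem_evenOdd_zero hb₀)]
  exact sub_mem (mul_mem_evenOdd_zero ha₁ hb₁) (mul_mem_evenOdd_zero hb₁ ha₁)

theorem exteriorAlgebra_lie_lie (a b c : ExteriorAlgebra R M) : ⁅⁅a, b⁆, c⁆ = 0 :=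
  sub_eq_zero.2 (commute_of_mem_evenOdd_zero (lie_mem_evenOdd_zero a b) c).eq

end ExteriorAlgebra

section Degrees

theorem exists_nat_combination {m n : ℤ} (hm : m < 0) (hn : 0 < n) (hmn : Int.gcd m n = 1)
    (r : ℤ) : ∃ a b : ℕ, 0 < a + b ∧ (a * m + b * n : ℤ) = r := by
  obtain ⟨p, q, hpq⟩ : ∃ p q : ℤ, p * m + q * n = r := by
    obtain ⟨p, q, h⟩ := Int.isCoprime_iff_gcd_eq_one.2 hmn
    exact ⟨r * p, r * q, by linear_combination r * h⟩
  have hp : 0 < p + (|p| + |q| + 1) * n := by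
    nlinarith [neg_abs_le p, abs_nonneg p, abs_nonneg q]
  have hq : 0 ≤ q + (|p| + |q| + 1) * (-m) := by
    nlinarith [neg_abs_le q, abs_nonneg p, abs_nonneg q]
  lift p + (|p| + |q| + 1) * n to ℕ using hp.le with a ha
  lift q + (|p| + |q| + 1) * (-m) to ℕ using hq with b hb
  refine ⟨a, b, by omega, ?_⟩
  rw [ha, hb]
  linear_combination hpq

theorem exists_nat_combination_of_even_mul {m n : ℤ} (hm : m < 0) (hn : 0 < n)
    (hmn : Int.gcd m n = 1) (he : Even (m * n)) (r : ℤ) (p : ZMod 2) :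
    ∃ a b : ℕ, 0 < a + b ∧ (a * m + b * n : ℤ) = r ∧ ((a + b : ℕ) : ZMod 2) = p := by
  obtain ⟨a, b, hab, h⟩ := exists_nat_combination hm hn hmn r
  by_cases hp : ((a + b : ℕ) : ZMod 2) = p
  · exact ⟨a, b, hab, h, hp⟩
  lift n to ℕ using hn.le
  obtain ⟨k, rfl⟩ : ∃ k : ℕ, m = -k := ⟨m.natAbs, by omega⟩
  have hodd : Odd (n + k) := by
    have hnot : ¬ (Even k ∧ Even n) := fun ⟨hk, hn⟩ =>
      Nat.not_coprime_of_dvd_of_dvd one_lt_two hk.two_dvd hn.two_dvd (by simpa using hmn)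
    have hor : Even k ∨ Even n := by simpa [Int.even_mul] using he
    grind
  refine ⟨a + n, b + k, by omega, by push_cast; linear_combination h, ?_⟩
  rw [add_add_add_comm, Nat.cast_add, hodd.natCast_zmod_two]
  exact (by decide : ∀ i j : ZMod 2, i ≠ j → i + 1 = j) _ _ hp

theorem exists_disjoint_family {ι α : Type*} [Finite ι] {Q : ι → Finset α → Prop}
    (hQ : ∀ i, ∀ U : Finset α, ∃ v, Disjoint U v ∧ Q i v) :
    ∃ S : ι → Finset α, (∀ i, Q i (S i)) ∧ Pairwise fun i j => Disjoint (S i) (S j) := by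
  classical
  induction ι using Finite.induction_empty_option with
  | of_equiv e ih =>
    obtain ⟨S, hS, hdisj⟩ := ih fun i => hQ (e i)
    exact ⟨S ∘ e.symm, fun i => by simpa using hS (e.symm i), fun i j h => hdisj (by simpa using h)⟩
  | h_empty => exact ⟨fun _ => ∅, nofun, nofun⟩
  | @h_option ι _ ih =>
    have := Fintype.ofFinite ι
    obtain ⟨S, hS, hdisj⟩ := ih fun i => hQ (some i)
    obtain ⟨v, hv, hQv⟩ := hQ none (Finset.univ.biUnion S)
    have hSv i : Disjoint (S i) v := (Finset.disjoint_biUnion_left _ _ _).1 hv i (Finset.mem_univ i)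
    refine ⟨fun i => i.elim v S, Option.forall.2 ⟨hQv, hS⟩, ?_⟩
    rintro (_ | i) (_ | j) hij
    · exact absurd rfl hij
    · exact (hSv j).symm
    · exact hSv i
    · exact hdisj fun h => hij (congrArg some h)

end Degrees

namespace TwoInduced

section Monomials

variable {F L : Type*} [Field F] [AddCommGroup L] [Module F L] {m n : ℤ} {u v : ℕ∞}
  (D : TwoInduced F L m n u v) {s t : Finset ℕ}

open CliffordAlgebra

theorem monomial_ne_zero (s : Finset ℕ) : D.monomial s ≠ 0 :=
  D.basis.ExteriorAlgebra.ne_zero s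

theorem monomial_empty : D.monomial ∅ = 1 := by
  simp [monomial, ExteriorAlgebra.basis_apply_ofCard (n := 0) D.basis Finset.card_empty]

theorem exists_monomial_mul (h : Disjoint s t) :
    ∃ ε : ℤˣ, D.monomial s * D.monomial t = ε • D.monomial (s ∪ t) :=
  ⟨_, (ExteriorAlgebra.basis_mul_of_disjoint D.basis (⟨s, rfl⟩ : Set.powersetCard ℕ s.card)
    (⟨t, rfl⟩ : Set.powersetCard ℕ t.card) h).trans (by
      rw [Set.powersetCard.coe_disjUnion, Finset.disjUnion_eq_union]; rfl)⟩

theorem monomial_mul_self (hs : s.Nonempty) : D.monomial s * D.monomial s = 0 :=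
  ExteriorAlgebra.basis_mul_of_not_disjoint D.basis
    (⟨s, rfl⟩ : Set.powersetCard ℕ s.card) (⟨s, rfl⟩ : Set.powersetCard ℕ s.card)
    (by simpa using hs.ne_empty)

theorem monomial_mem_evenOdd (s : Finset ℕ) :
    D.monomial s ∈ evenOdd (0 : QuadraticForm F L) (s.card : ZMod 2) := by
  refine Submodule.mem_iSup_of_mem ⟨s.card, rfl⟩ ?_
  rw [monomial, ExteriorAlgebra.basis_eq_coe_basis D.basis
    (⟨s, rfl⟩ : Set.powersetCard ℕ s.card)]
  exact SetLike.coe_mem _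

theorem exists_prod_monomial {ι : Type*} [DecidableEq ι] {S : ι → Finset ℕ}
    (hS : Pairwise fun i j => Disjoint (S i) (S j)) {l : List ι} (hl : l.Nodup) :
    ∃ ε : ℤˣ, (l.map fun i => D.monomial (S i)).prod = ε • D.monomial (l.toFinset.biUnion S) := by
  induction l with
  | nil => exact ⟨1, by simp [monomial_empty]⟩
  | cons i l ih =>
    obtain ⟨hi, hl⟩ := List.nodup_cons.1 hl
    obtain ⟨ε, hε⟩ := ih hl
    obtain ⟨δ, hδ⟩ := D.exists_monomial_mul (s := S i) (t := l.toFinset.biUnion S)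
      ((Finset.disjoint_biUnion_right _ _ _).2 fun j hj =>
        hS (ne_of_mem_of_not_mem (List.mem_toFinset.1 hj) hi).symm)
    refine ⟨ε * δ, ?_⟩
    rw [List.map_cons, List.prod_cons, hε, List.toFinset_cons, Finset.biUnion_insert,
      mul_smul_comm, hδ, smul_smul]

theorem prod_monomial_ne_zero {ι : Type*} {S : ι → Finset ℕ}
    (hS : Pairwise fun i j => Disjoint (S i) (S j)) {l : List ι} (hl : l.Nodup) :
    (l.map fun i => D.monomial (S i)).prod ≠ 0 := by
  classical
  obtain ⟨ε, hε⟩ := D.exists_prod_monomial hS hl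
  rw [hε]
  exact (smul_ne_zero_iff_ne ε).2 (D.monomial_ne_zero _)

theorem card_eq_sum_deg (hmn : Odd (m * n)) (s : Finset ℕ) :
    (s.card : ZMod 2) = (∑ i ∈ s, D.deg i : ℤ) := by
  obtain ⟨hm, hn⟩ := Int.odd_mul.1 hmn
  have hdeg i : Odd (D.deg i) := by rcases D.deg_eq i with h | h <;> rwa [h]
  rw [Int.cast_sum, Finset.sum_congr rfl fun i _ => (hdeg i).intCast_zmod_two, Finset.sum_const,
    nsmul_one]

theorem component_le_evenOdd (hmn : Odd (m * n)) (r : ℤ) :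
    D.component r ≤ evenOdd (0 : QuadraticForm F L) (r : ZMod 2) := by
  refine Submodule.span_le.2 ?_
  rintro _ ⟨s, rfl, rfl⟩
  rw [SetLike.mem_coe, ← D.card_eq_sum_deg hmn]
  exact D.monomial_mem_evenOdd s

/-- The degree `r` is attained by nonempty basis monomials with length of parity `p` which avoid any
prescribed finite set of basis vectors. -/
def HasFreshMonomials (r : ℤ) (p : ZMod 2) : Prop :=
  ∀ U : Finset ℕ, ∃ s, Disjoint U s ∧ s.Nonempty ∧ ∑ i ∈ s, D.deg i = r ∧ (s.card : ZMod 2) = p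

theorem component_ne_bot {D : TwoInduced F L m n u v} {r : ℤ} {p : ZMod 2}
    (h : D.HasFreshMonomials r p) : D.component r ≠ ⊥ := by
  obtain ⟨s, -, -, rfl, -⟩ := h ∅
  exact (Submodule.ne_bot_iff _).2 ⟨_, D.monomial_mem s, D.monomial_ne_zero s⟩

end Monomials

section InfiniteSummands

variable {F L : Type*} [Field F] [AddCommGroup L] [Module F L] {m n : ℤ}
  (D : TwoInduced F L m n ⊤ ⊤)

theorem hasFreshMonomials (hmn : m ≠ n) {a b : ℕ} (hab : 0 < a + b) :
    D.HasFreshMonomials (a * m + b * n) ((a + b : ℕ) : ZMod 2) := by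
  intro U
  obtain ⟨s, hs, rfl⟩ := ((Set.encard_eq_top_iff.1 D.encard_left).sdiff
    U.finite_toSet).exists_subset_card_eq a
  obtain ⟨t, ht, rfl⟩ := ((Set.encard_eq_top_iff.1 D.encard_right).sdiff
    U.finite_toSet).exists_subset_card_eq b
  have hsm : ∀ k ∈ s, D.deg k = m := fun k hk => (hs hk).1
  have htn : ∀ k ∈ t, D.deg k = n := fun k hk => (ht hk).1
  have hst : Disjoint s t := Finset.disjoint_left.2 fun k hk hk' =>
    hmn ((hsm k hk).symm.trans (htn k hk'))
  have hcard : (s ∪ t).card = s.card + t.card := Finset.card_union_of_disjoint hst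
  refine ⟨s ∪ t, ?_, Finset.card_pos.1 (hcard ▸ hab), ?_, congrArg _ hcard⟩
  · exact Finset.disjoint_union_right.2 ⟨Finset.disjoint_right.2 fun k hk => (hs hk).2,
      Finset.disjoint_right.2 fun k hk => (ht hk).2⟩
  · rw [Finset.sum_union hst, Finset.sum_congr rfl hsm, Finset.sum_congr rfl htn]
    simp

theorem hasFreshMonomials_of_even (hm : m < 0) (hn : 0 < n) (hmn : Int.gcd m n = 1)
    (he : Even (m * n)) (r : ℤ) (p : ZMod 2) : D.HasFreshMonomials r p := by
  obtain ⟨a, b, hab, rfl, rfl⟩ := exists_nat_combination_of_even_mul hm hn hmn he r p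
  exact D.hasFreshMonomials (hm.trans hn).ne hab

theorem hasFreshMonomials_of_odd (hm : m < 0) (hn : 0 < n) (hmn : Int.gcd m n = 1)
    (ho : Odd (m * n)) (r : ℤ) : D.HasFreshMonomials r (r : ZMod 2) := by
  obtain ⟨a, b, hab, rfl⟩ := exists_nat_combination hm hn hmn r
  convert D.hasFreshMonomials (hm.trans hn).ne hab using 1
  obtain ⟨hmo, hno⟩ := Int.odd_mul.1 ho
  push_cast
  rw [hmo.intCast_zmod_two, hno.intCast_zmod_two, mul_one, mul_one]

theorem support_eq_univ (hm : m < 0) (hn : 0 < n) (hmn : Int.gcd m n = 1) :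
    D.support = Set.univ :=
  Set.eq_univ_of_forall fun r => (Int.even_or_odd (m * n)).elim
    (fun he => component_ne_bot (D.hasFreshMonomials_of_even hm hn hmn he r 0))
    fun ho => component_ne_bot (D.hasFreshMonomials_of_odd hm hn hmn ho r)

end InfiniteSummands

end TwoInduced

namespace TwoInduced

section Separation

variable {F L X : Type*} [Field F] [AddCommGroup L] [Module F L] {m n : ℤ} {u v : ℕ∞}
  (D : TwoInduced F L m n u v) [DecidableEq X] {s : Multiset X} {T : Finset X}

theorem prod_smul_prod_ne_zero [CharZero F] {S : (Σ x, Fin (s.count x)) ⊕ T → Finset ℕ}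
    (hS : Pairwise fun i j => Disjoint (S i) (S j))
    {w : (Σ x, Fin (s.count x)) → Subring.center (ExteriorAlgebra F L)}
    (hw : ∀ p, (w p : ExteriorAlgebra F L) = D.monomial (S (.inl p))) (hww : ∀ p, w p * w p = 0)
    {z : X → ExteriorAlgebra F L} (hz : ∀ x : T, z x = D.monomial (S (.inr x))) :
    (s.map fun x => ∑ j, w ⟨x, j⟩).prod • (T.toList.map z).prod ≠ 0 := by
  have : IsAddTorsionFree (ExteriorAlgebra F L) := .of_isTorsionFree F _
  let P := s.toFinset.sigma fun x => (Finset.univ : Finset (Fin (s.count x)))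
  have hP : ((∏ p ∈ P, w p : Subring.center (ExteriorAlgebra F L)) : ExteriorAlgebra F L) =
      ((P.toList.map Sum.inl).map fun i => D.monomial (S i)).prod := by
    rw [← Finset.prod_map_toList, SubmonoidClass.coe_list_prod, List.map_map, List.map_map]
    simp only [Function.comp_def, hw]
  have hT : (T.toList.map z).prod =
      ((T.toList.pmap (fun x hx => Sum.inr ⟨x, hx⟩) fun _ => Finset.mem_toList.1).map
        fun i => D.monomial (S i)).prod := by
    rw [List.map_pmap, ← List.pmap_eq_map (p := (· ∈ T)) (H := fun _ => Finset.mem_toList.1)]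
    exact congrArg List.prod (List.pmap_congr_left _ fun x _ hx _ => hz ⟨x, hx⟩)
  rw [prod_map_sum_of_mul_self_eq_zero hww, smul_assoc, Subring.smul_def, smul_eq_mul, hP, hT,
    ← List.prod_append, ← List.map_append]
  refine smul_ne_zero (Finset.prod_ne_zero_iff.2 fun x _ => Nat.factorial_ne_zero _)
    (D.prod_monomial_ne_zero hS (List.Nodup.append (P.nodup_toList.map Sum.inl_injective) ?_ ?_))
  · exact T.nodup_toList.pmap fun x hx y hy h => congrArg Subtype.val (Sum.inr_injective h)
  · simp [List.disjoint_left]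

theorem exists_disjoint_monomials {ι : Type*} [Finite ι] {d : ι → ℤ} {p : ι → ZMod 2}
    (h : ∀ i, D.HasFreshMonomials (d i) (p i)) :
    ∃ S : ι → Finset ℕ, (Pairwise fun i j => Disjoint (S i) (S j)) ∧ (∀ i, (S i).Nonempty) ∧
      (∀ i, D.monomial (S i) ∈ D.component (d i)) ∧
      ∀ i, D.monomial (S i) ∈ CliffordAlgebra.evenOdd (0 : QuadraticForm F L) (p i) := by
  obtain ⟨S, hS, hdisj⟩ := exists_disjoint_family h
  exact ⟨S, hdisj, fun i => (hS i).1, fun i => (hS i).2.1 ▸ D.monomial_mem (S i),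
    fun i => (hS i).2.2 ▸ D.monomial_mem_evenOdd (S i)⟩

theorem exists_separatingSubstitution [CharZero F] {d : X → ℤ}
    (hs : ∀ x ∈ s, D.HasFreshMonomials (d x) 0) (hT : ∀ x ∈ T, D.HasFreshMonomials (d x) 1) :
    ∃ σ : SeparatingSubstitution (Subring.center (ExteriorAlgebra F L)) (ExteriorAlgebra F L) s T,
      ∀ x, σ.toFun x ∈ D.component (d x) := by
  have : Finite (Σ x, Fin (s.count x)) := inferInstanceAs (Finite s)
  obtain ⟨S, hdisj, hne, hmem, hparity⟩ := D.exists_disjoint_monomials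
    (d := Sum.elim (fun p : Σ x, Fin (s.count x) => d p.1) fun x : T => d x)
    (p := Sum.elim (fun _ => 0) fun _ => 1) (Sum.forall.2
      ⟨fun p => hs p.1 (Multiset.count_pos.1 p.2.pos), fun x => hT x x.2⟩)
  let w p : Subring.center (ExteriorAlgebra F L) :=
    ⟨D.monomial (S (.inl p)), mem_center_of_mem_evenOdd_zero (hparity (.inl p))⟩
  have hw p : w p * w p = 0 := Subtype.ext (D.monomial_mul_self (hne (.inl p)))
  let z x := if hx : x ∈ T then D.monomial (S (.inr ⟨x, hx⟩)) else 0
  have hz (x : T) : z x = D.monomial (S (.inr x)) := dif_pos x.2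
  have hz₀ x (hx : x ∉ T) : z x = 0 := dif_neg hx
  have hz_mem {V : Submodule F (ExteriorAlgebra F L)} {x : X}
      (h : ∀ hx : x ∈ T, D.monomial (S (.inr ⟨x, hx⟩)) ∈ V) : z x ∈ V := by
    by_cases hx : x ∈ T
    · exact hz ⟨x, hx⟩ ▸ h hx
    · exact hz₀ x hx ▸ zero_mem _
  have hz₁ x : z x ∈ CliffordAlgebra.evenOdd (0 : QuadraticForm F L) 1 :=
    hz_mem fun hx => hparity (.inr ⟨x, hx⟩)
  refine ⟨{
    even := fun x => ∑ j, w ⟨x, j⟩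
    odd := z
    odd_mul_odd := fun x y => mul_eq_neg_mul_of_mem_evenOdd_one (hz₁ x) (hz₁ y)
    odd_mul_self := fun x => ?_
    odd_eq_zero := hz₀
    even_pow_eq_zero := fun x => ?_
    top_ne_zero := D.prod_smul_prod_ne_zero hdisj (fun _ => rfl) hw hz }, fun x => ?_⟩
  · by_cases hx : x ∈ T
    · rw [hz ⟨x, hx⟩, D.monomial_mul_self (hne (.inr ⟨x, hx⟩))]
    · rw [hz₀ x hx, mul_zero]
  · simpa using sum_pow_card_add_one_of_mul_self_eq_zero (P := Finset.univ)
      (w := fun j => w ⟨x, j⟩) fun j _ => hw _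
  · refine add_mem ?_ (hz_mem fun hx => hmem (.inr ⟨x, hx⟩))
    rw [map_sum]
    exact sum_mem fun j _ => hmem (.inl ⟨x, j⟩)

end Separation

end TwoInduced

section Varieties

open FreeAlgebra (ι lift)

variable {F : Type*} [Field F]

theorem span_mkₐ_comp_normalForm_definingV1 :
    Submodule.span F (((tIdealSpan (definingV1 F)).ringCon.mkₐ F ∘
      normalForm (ι F) commutatorProd) '' {i | Even i.2.card}) = ⊤ := by
  rw [show (tIdealSpan (definingV1 F)).ringCon.mkₐ F ∘ normalForm (ι F) commutatorProd =
    normalForm _ commutatorProd from funext (map_normalForm (ι F) (map_commutatorProd _))]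
  exact span_normalForm_commutatorProd lie_lie_eq_zero_of_tIdealSpan_definingV1
    (adjoin_range_mkₐ_comp_ι _)

theorem mkₐ_ι_mul_eq_of_even {i j : ℤ × ℕ} (h : Even i.1 ∨ Even j.1) :
    (tIdealSpan (definingV2 F)).ringCon.mkₐ F (ι F i) *
        (tIdealSpan (definingV2 F)).ringCon.mkₐ F (ι F j) =
      (tIdealSpan (definingV2 F)).ringCon.mkₐ F (ι F j) *
        (tIdealSpan (definingV2 F)).ringCon.mkₐ F (ι F i) := by
  have hmem : ⁅x F i.1 i.2, x F j.1 j.2⁆ ∈ tIdealSpan (definingV2 F) :=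
    subset_tIdealSpan (.inl ⟨_, _, _, _, h, rfl⟩)
  rw [← sub_eq_zero, ← map_mul, ← map_mul, ← map_sub]
  exact mkₐ_eq_zero_iff.2 hmem

theorem mkₐ_ι_mul_eq_neg_of_odd {i j : ℤ × ℕ} (hi : Odd i.1) (hj : Odd j.1) :
    (tIdealSpan (definingV2 F)).ringCon.mkₐ F (ι F i) *
        (tIdealSpan (definingV2 F)).ringCon.mkₐ F (ι F j) =
      -((tIdealSpan (definingV2 F)).ringCon.mkₐ F (ι F j) *
        (tIdealSpan (definingV2 F)).ringCon.mkₐ F (ι F i)) := by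
  have hmem : x F i.1 i.2 * x F j.1 j.2 + x F j.1 j.2 * x F i.1 i.2 ∈ tIdealSpan (definingV2 F) :=
    subset_tIdealSpan (.inr ⟨_, _, _, _, ⟨hi, hj⟩, rfl⟩)
  rw [eq_neg_iff_add_eq_zero, ← map_mul, ← map_mul, ← map_add]
  exact mkₐ_eq_zero_iff.2 hmem

theorem span_mkₐ_comp_normalForm_definingV2 [CharZero F] :
    Submodule.span F (((tIdealSpan (definingV2 F)).ringCon.mkₐ F ∘ normalForm (ι F) List.prod) ''
      {i | (∀ a ∈ i.1, ¬ Odd a.1) ∧ ∀ a ∈ i.2, Odd a.1}) = ⊤ := by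
  rw [show (tIdealSpan (definingV2 F)).ringCon.mkₐ F ∘ normalForm (ι F) List.prod =
    normalForm _ List.prod from funext (map_normalForm (ι F) (map_list_prod _))]
  refine span_normalForm_prod (adjoin_range_mkₐ_comp_ι (tIdealSpan (definingV2 F)))
    {a | Odd a.1} (fun i j => ?_) (fun i hi => ?_)
  · by_cases h : Even i.1 ∨ Even j.1
    · exact ⟨1, by rw [one_smul]; exact mkₐ_ι_mul_eq_of_even h⟩
    · rw [not_or, Int.not_even_iff_odd, Int.not_even_iff_odd] at h
      exact ⟨-1, by rw [Units.neg_smul, one_smul]; exact mkₐ_ι_mul_eq_neg_of_odd h.1 h.2⟩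
  · have h := eq_neg_iff_add_eq_zero.1 (mkₐ_ι_mul_eq_neg_of_odd (F := F) hi hi)
    rw [← two_smul F] at h
    exact (smul_eq_zero.1 h).resolve_left two_ne_zero

namespace TwoInduced

variable {L : Type*} [AddCommGroup L] [Module F L] {m n : ℤ} {u v : ℕ∞}
  (D : TwoInduced F L m n u v)

theorem tIdealSpan_definingV1_le :
    tIdealSpan (definingV1 F) ≤ gradedIdentities D.component := by
  refine tIdealSpan_le_gradedIdentities ?_
  rintro _ ⟨i, j, l, p, q, r, rfl⟩
  refine (mem_gradedIdentities _ _).2 fun a _ => ?_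
  simpa only [Ring.lie_def, map_sub, map_mul] using exteriorAlgebra_lie_lie (lift F a (x F i p))
    (lift F a (x F j q)) (lift F a (x F l r))

theorem tIdealSpan_definingV2_le (hmn : Odd (m * n)) :
    tIdealSpan (definingV2 F) ≤ gradedIdentities D.component := by
  refine tIdealSpan_le_gradedIdentities ?_
  rintro _ (⟨i, j, p, q, hij, rfl⟩ | ⟨i, j, p, q, ⟨hi, hj⟩, rfl⟩) <;>
    refine (mem_gradedIdentities _ _).2 fun a ha => ?_
  · rw [Ring.lie_def, map_sub, map_mul, map_mul, FreeAlgebra.lift_ι_apply,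
      FreeAlgebra.lift_ι_apply, sub_eq_zero]
    rcases hij with hi | hj
    · refine commute_of_mem_evenOdd_zero ?_ _
      exact hi.intCast_zmod_two ▸ D.component_le_evenOdd hmn _ (ha (i, p))
    · refine (commute_of_mem_evenOdd_zero ?_ _).symm
      exact hj.intCast_zmod_two ▸ D.component_le_evenOdd hmn _ (ha (j, q))
  · rw [map_add, map_mul, map_mul, FreeAlgebra.lift_ι_apply, FreeAlgebra.lift_ι_apply,
      ← eq_neg_iff_add_eq_zero]
    exact mul_eq_neg_mul_of_mem_evenOdd_one
      (hi.intCast_zmod_two ▸ D.component_le_evenOdd hmn _ (ha (i, p)))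
      (hj.intCast_zmod_two ▸ D.component_le_evenOdd hmn _ (ha (j, q)))

theorem gradedIdentities_eq_definingV1 [CharZero F] (h : ∀ r p, D.HasFreshMonomials r p) :
    gradedIdentities D.component = tIdealSpan (definingV1 F) := by
  have : IsAddTorsionFree (ExteriorAlgebra F L) := .of_isTorsionFree F _
  refine gradedIdentities_eq_of_triangular D.component D.tIdealSpan_definingV1_le
    (fun i => toLex (i.2.card, i.1.card)) span_mkₐ_comp_normalForm_definingV1 ?_
  rintro ⟨s, T⟩ hT
  obtain ⟨σ, hσ⟩ := D.exists_separatingSubstitution (s := s) (T := T) (d := Prod.fst)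
    (fun _ _ => h _ _) (fun _ _ => h _ _)
  have hlift i : lift F σ.toFun (normalForm (ι F) commutatorProd i) =
      normalForm σ.toFun commutatorProd i := by
    rw [map_normalForm (ι F) (map_commutatorProd _), FreeAlgebra.ι_comp_lift]
  have hprod {T' : Finset (ℤ × ℕ)} (hT' : Even T'.card) :=
    σ.commutatorProd_toFun (t := T'.toList) (by rwa [Finset.length_toList])
  refine ⟨σ.toFun, hσ, ?_, fun j hj hne hle => ?_⟩
  · rw [hlift]
    exact σ.normalForm_toFun_ne_zero (pow_ne_zero _ two_ne_zero) (hprod hT)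
  · rw [hlift]
    exact σ.normalForm_toFun_eq_zero (hprod hj) hne hle

theorem gradedIdentities_eq_definingV2 [CharZero F] (hmn : Odd (m * n))
    (h : ∀ r : ℤ, D.HasFreshMonomials r r) :
    gradedIdentities D.component = tIdealSpan (definingV2 F) := by
  have : IsAddTorsionFree (ExteriorAlgebra F L) := .of_isTorsionFree F _
  refine gradedIdentities_eq_of_triangular D.component (D.tIdealSpan_definingV2_le hmn)
    (fun i => toLex (i.2.card, i.1.card)) span_mkₐ_comp_normalForm_definingV2 ?_
  rintro ⟨s, T⟩ ⟨hs, hT⟩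
  obtain ⟨σ, hσ⟩ := D.exists_separatingSubstitution (s := s) (T := T) (d := Prod.fst)
    (fun i hi => (Int.not_odd_iff_even.1 (hs i hi)).intCast_zmod_two ▸ h _)
    (fun i hi => (hT i hi).intCast_zmod_two ▸ h _)
  have hlift i : lift F σ.toFun (normalForm (ι F) List.prod i) =
      normalForm σ.toFun List.prod i := by
    rw [map_normalForm (ι F) (map_list_prod _), FreeAlgebra.ι_comp_lift]
  have hprod {T' : Finset (ℤ × ℕ)} (hT' : ∀ i ∈ T', Odd i.1) :
      (T'.toList.map σ.toFun).prod = 1 • (T'.toList.map σ.odd).prod := by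
    rw [one_smul]
    exact congrArg List.prod (List.map_congr_left fun i hi =>
      σ.toFun_eq_odd fun his => hs i his (hT' i (Finset.mem_toList.1 hi)))
  refine ⟨σ.toFun, hσ, ?_, fun j hj hne hle => ?_⟩
  · rw [hlift]
    exact σ.normalForm_toFun_ne_zero one_ne_zero (hprod hT)
  · rw [hlift]
    exact σ.normalForm_toFun_eq_zero (hprod hj.2) hne hle

theorem lie_notMem_gradedIdentities [CharZero F] {r : ℤ} (h : D.HasFreshMonomials r 1) :
    ⁅x F r 0, x F r 1⁆ ∉ gradedIdentities D.component := by
  obtain ⟨s, -, -, hs, hs₁⟩ := h ∅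
  obtain ⟨t, hst, -, ht, ht₁⟩ := h s
  intro hmem
  let a : ℤ × ℕ → ExteriorAlgebra F L := fun p =>
    if p = (r, 0) then D.monomial s else if p = (r, 1) then D.monomial t else 0
  have ha p : a p ∈ D.component p.1 := by
    simp only [a]
    split_ifs with h₀ h₁
    · exact h₀ ▸ hs ▸ D.monomial_mem s
    · exact h₁ ▸ ht ▸ D.monomial_mem t
    · exact zero_mem _
  have hcomm : D.monomial s * D.monomial t = D.monomial t * D.monomial s := by
    simpa [a, Ring.lie_def, sub_eq_zero] using (mem_gradedIdentities _ _).1 hmem a ha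
  have hanti := mul_eq_neg_mul_of_mem_evenOdd_one (hs₁ ▸ D.monomial_mem_evenOdd s)
    (ht₁ ▸ D.monomial_mem_evenOdd t)
  obtain ⟨ε, hε⟩ := D.exists_monomial_mul hst
  have : IsAddTorsionFree (ExteriorAlgebra F L) := .of_isTorsionFree F _
  rw [← hcomm, self_eq_neg, hε] at hanti
  exact (smul_ne_zero_iff_ne ε).2 (D.monomial_ne_zero _) hanti

end TwoInduced

end Varieties

end

end GradedGrassmann

theorem theorem4p1 {F : Type*} [Field F] [CharZero F] {L : Type*} [AddCommGroup L] [Module F L]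
    {m n : ℤ} (hm : m < 0) (hn : 0 < n) (hmn : Int.gcd m n = 1)
    (E : GradedGrassmann.TwoInduced F L m n ⊤ ⊤)
    (E₁ : GradedGrassmann.TwoInduced F L (-1) 1 ⊤ ⊤)
    (E₂ : GradedGrassmann.TwoInduced F L (-1) 2 ⊤ ⊤) :
    E.support = Set.univ ∧
    (Odd (m * n) →
      GradedGrassmann.PIEquiv E.component E₁.component ∧
      GradedGrassmann.GeneratesVariety E.component (GradedGrassmann.definingV2 F)) ∧
    (Even (m * n) →
      GradedGrassmann.PIEquiv E.component E₂.component ∧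
      GradedGrassmann.GeneratesVariety E.component (GradedGrassmann.definingV1 F)) ∧
    ¬ GradedGrassmann.PIEquiv E₁.component E₂.component := by
  have h₁ := E₁.gradedIdentities_eq_definingV2 (by decide)
    (E₁.hasFreshMonomials_of_odd (by norm_num) one_pos (by norm_num) (by decide))
  have hfresh₂ := E₂.hasFreshMonomials_of_even (by norm_num) two_pos (by norm_num) (by decide)
  have h₂ := E₂.gradedIdentities_eq_definingV1 hfresh₂
  refine ⟨E.support_eq_univ hm hn hmn, fun ho => ?_, fun he => ?_, fun h => ?_⟩
  · have hE := E.gradedIdentities_eq_definingV2 ho (E.hasFreshMonomials_of_odd hm hn hmn ho)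
    exact ⟨hE.trans h₁.symm, hE⟩
  · have hE := E.gradedIdentities_eq_definingV1 (E.hasFreshMonomials_of_even hm hn hmn he)
    exact ⟨hE.trans h₂.symm, hE⟩
  · have hmem : ⁅GradedGrassmann.x F 0 0, GradedGrassmann.x F 0 1⁆ ∈
        GradedGrassmann.tIdealSpan (GradedGrassmann.definingV2 F) :=
      GradedGrassmann.subset_tIdealSpan (.inl ⟨0, 0, 0, 1, .inl .zero, rfl⟩)
    rw [← h₁, h] at hmem
    exact E₂.lie_notMem_gradedIdentities (hfresh₂ 0 1) hmem
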